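/- Let $X$ be a finite discrete space with at least two elements, $\Gamma$ a nonempty countable set and $\varphi:\Gamma\to\Gamma$ a map. Give $X^\Gamma$ the product topology, let $d$ be any metric on $X^\Gamma$ inducing this topology (for instance $d(x,y)=\sum_{n\ge1}2^{-n}\delta(x_{\beta_n},y_{\beta_n})$, where $\Gamma=\{\beta_1,\beta_2,\dots\}$ is an enumeration without repetitions, the sum runs over the indices of the enumeration, $\delta(a,a)=0$, and $\delta(a,b)=1$ for $a\ne b$), and let $f=\sigma_\varphi:X^\Gamma\to X^\Gamma$, $\sigma_\varphi((x_\alpha)_{\alpha\in\Gamma})=(x_{\varphi(\alpha)})_{\alpha\in\Gamma}$. A pair $(x,y)$ is scrambled if $\liminf_{n\to\infty} d(f^n(x),f^n(y))=0$ and $\limsup_{n\to\infty} d(f^n(x),f^n(y))>0$. For $V\subseteq X^\Gamma$ and $\varepsilon>0$ let $N(V,\varepsilon)=\{n\ge0:\exists x,y\in V,\ d(f^n(x),f^n(y))>\varepsilon\}$. Then the following statements are equivalent: 1. $(X^\Gamma,\sigma_\varphi)$ is Li-Yorke chaotic: there is an uncountable $A\subseteq X^\Gamma$ such that all $x\neq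 y$ in $A$ form a scrambled pair; 2. $(X^\Gamma,\sigma_\varphi)$ has a scrambled pair; 3. $(X^\Gamma,\sigma_\varphi)$ is topologically chaotic: its topological entropy is positive; 4. $(X^\Gamma,\sigma_\varphi)$ is sensitive: there is $\varepsilon>0$ such that for all $x\in X^\Gamma$ and all open $V\ni x$ there are $y\in V$ and $n\ge0$ with $d(f^n(x),f^n(y))>\varepsilon$; 5. $(X^\Gamma,\sigma_\varphi)$ is strongly sensitive: there is $\varepsilon>0$ such that for all $x\in X^\Gamma$ and all open $V\ni x$ there are $y\in V$ and $n_0\ge0$ with $d(f^n(x),f^n(y))>\varepsilon$ for all $n\ge n_0$; 6. $(X^\Gamma,\sigma_\varphi)$ is asymptotic sensitive: there is $\varepsilon>0$ such that for all $x\in X^\Gamma$ and all open $V\ni x$ there is $y\in V$ with $\limsup_{n\to\infty} d(f^n(x),f^n(y))>\varepsilon$; 7. $(X^\Gamma,\sigma_\varphi)$ is syndetically sensitive: there is $\varepsilon>0$ such that for every nonempty open $V$ the set $N(V,\varepsilon)$ is syndetic, i.e. there is $N\ge1$ with $\{i,i+1,\dots,i+N\}\cap N(V,\varepsilon)\neq\varnothing$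 for all $i\ge1$; 8. $(X^\Gamma,\sigma_\varphi)$ is cofinitely sensitive: there is $\varepsilon>0$ such that for every nonempty open $V$ the set $N(V,\varepsilon)$ has finite complement in $\{0,1,2,\dots\}$; 9. $(X^\Gamma,\sigma_\varphi)$ is multi-sensitive: there is $\varepsilon>0$ such that $\bigcap_{i=1}^k N(V_i,\varepsilon)\ne\varnothing$ for all $k\ge1$ and all nonempty open $V_1,\dots,V_k$; 10. $(X^\Gamma,\sigma_\varphi)$ is ergodically sensitive: there is $\varepsilon>0$ such that for every nonempty open $V$, $\limsup_{n\to\infty}\frac{|N(V,\varepsilon)\cap\{0,\dots,n\}|}{n+1}>0$; 11. $\varphi$ has a non-quasi-periodic point: there is $a\in\Gamma$ such that $\varphi^n(a)\neq\varphi^m(a)$ for all $n>m\ge1$. -/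

import Mathlib

namespace GenShift

open Filter Topology

/-- The generalized shift `σ_φ : X^Γ → X^Γ`, `(x_α)_α ↦ (x_{φ(α)})_α`. -/
def shift {X Γ : Type*} (φ : Γ → Γ) : (Γ → X) → (Γ → X) :=
  fun x α => x (φ α)

/-- `a` is a quasi-periodic point of `φ`. -/
def IsQuasiPeriodicPt {Γ : Type*} (φ : Γ → Γ) (a : Γ) : Prop :=
  ∃ n m : ℕ, n > m ∧ m ≥ 1 ∧ φ^[n] a = φ^[m] a

/-! Dynamical notions for a self-map `f` of a (compact) metric space `Z`. On a compact space the
sequences `n ↦ dist (f^[n] x) (f^[n] y)` are bounded, so that `limsup` and `liminf` in `ℝ` are the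
usual ones. -/

section Notions

variable {Z : Type*} [MetricSpace Z] (f : Z → Z)

/-- `(x, y)` is a scrambled pair. -/
def IsScrambledPair (x y : Z) : Prop :=
  liminf (fun n : ℕ => dist (f^[n] x) (f^[n] y)) atTop = 0 ∧
    limsup (fun n : ℕ => dist (f^[n] x) (f^[n] y)) atTop > 0

/-- A scrambled set: at least two elements, any two distinct ones forming a scrambled pair. -/
def IsScrambledSet (A : Set Z) : Prop :=
  A.Nontrivial ∧ ∀ x ∈ A, ∀ y ∈ A, x ≠ y → IsScrambledPair f x y

def HasScrambledPair : Prop :=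
  ∃ x y : Z, IsScrambledPair f x y

def IsLiYorkeChaotic : Prop :=
  ∃ A : Set Z, ¬ A.Countable ∧ IsScrambledSet f A

/-- Positive topological entropy. -/
def IsTopologicallyChaotic : Prop :=
  0 < Dynamics.coverEntropy f (Set.univ : Set Z)

def IsSensitive : Prop :=
  ∃ ε : ℝ, ε > 0 ∧ ∀ x : Z, ∀ V : Set Z, IsOpen V → x ∈ V →
    ∃ y ∈ V, ∃ n : ℕ, dist (f^[n] x) (f^[n] y) > ε

def IsStronglySensitive : Prop :=
  ∃ ε : ℝ, ε > 0 ∧ ∀ x : Z, ∀ V : Set Z, IsOpen V → x ∈ V →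
    ∃ y ∈ V, ∃ n₀ : ℕ, ∀ n ≥ n₀, dist (f^[n] x) (f^[n] y) > ε

def IsAsymptoticSensitive : Prop :=
  ∃ ε : ℝ, ε > 0 ∧ ∀ x : Z, ∀ V : Set Z, IsOpen V → x ∈ V →
    ∃ y ∈ V, limsup (fun n : ℕ => dist (f^[n] x) (f^[n] y)) atTop > ε

/-- The set `N(V, ε)` of times at which two points of `V` are more than `ε` apart. -/
def sepTimes (V : Set Z) (ε : ℝ) : Set ℕ :=
  {n : ℕ | ∃ x ∈ V, ∃ y ∈ V, dist (f^[n] x) (f^[n] y) > ε}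

/-- `A ⊆ {0, 1, 2, …}` is syndetic. -/
def IsSyndetic (A : Set ℕ) : Prop :=
  ∃ N : ℕ, N ≥ 1 ∧ ∀ i : ℕ, i ≥ 1 → (Set.Icc i (i + N) ∩ A).Nonempty

def IsSyndeticallySensitive : Prop :=
  ∃ ε : ℝ, ε > 0 ∧ ∀ V : Set Z, IsOpen V → V.Nonempty → IsSyndetic (sepTimes f V ε)

def IsCofinitelySensitive : Prop :=
  ∃ ε : ℝ, ε > 0 ∧ ∀ V : Set Z, IsOpen V → V.Nonempty → (sepTimes f V ε)ᶜ.Finite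

def IsMultiSensitive : Prop :=
  ∃ ε : ℝ, ε > 0 ∧ ∀ k : ℕ, k ≥ 1 → ∀ V : Fin k → Set Z,
    (∀ i, IsOpen (V i)) → (∀ i, (V i).Nonempty) → (⋂ i, sepTimes f (V i) ε).Nonempty

/-- `N(V, ε)` has positive upper density for every nonempty open `V`. -/
def IsErgodicallySensitive : Prop :=
  ∃ ε : ℝ, ε > 0 ∧ ∀ V : Set Z, IsOpen V → V.Nonempty →
    limsup (fun n : ℕ => ((sepTimes f V ε ∩ Set.Iic n).ncard : ℝ) / ((n : ℝ) + 1)) atTop > 0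

end Notions

end GenShift

/-!
Everything is governed by the orbits of `φ`, because `(σ_φⁿ x)(α) = x (φⁿ α)`.

By compactness of `X^Γ`, a metric inducing the product topology induces the product uniformity, for
which the relations "`x` and `y` agree on `F`", with `F ⊆ Γ` finite, form a basis
(`hasCylinderBasis`). This is all that is used of the metric, apart from its boundedness.

If every point of `Γ` is quasi-periodic, every orbit of `φ` is finite, so each finite `F` lies in a
finite forward-invariant set `G` (`exists_finite_superset_mapsTo`). Points which agree on `G` at one
time agree on `G` from then on. Hence the iterates of `σ_φ` are equicontinuous, which excludes
every form of sensitivity; two orbits that come close once stay close, which excludes scrambled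
pairs; and the covering numbers are bounded in time by `|X|^|G|`, so that the entropy vanishes.

If `a` is not quasi-periodic, then `k ↦ φᵏ(a)` is injective, and a point of `X^Γ` may be prescribed
freely along this orbit.
* Changing `x` at all `φᵏ(a)` with `k` large leaves `x` in a given neighbourhood and moves
  `σ_φᵏ x` at the coordinate `a` for all large `k`: this is strong sensitivity
  (`isStronglySensitive_of_not_isQuasiPeriodicPt`), from which the other forms of sensitivity follow.
* The `2ⁿ` prescriptions along `a, φ(a), …, φⁿ⁻¹(a)` give an `(n, ε)`-separated set, so that the
  entropy is at least `log 2`.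
* For an uncountable scrambled set, a binary sequence `s` is written into the coordinates
  `φ^(m²)(a)`, each entry of `s` infinitely often (`codedPoint`). Two codes for distinct sequences
  differ at infinitely many squares, but the gaps between the squares are arbitrarily long, and an
  orbit of `φ` that meets the orbit of `a` runs along it with a constant time shift; so the two
  points agree on any finite set of coordinates at infinitely many times.
-/

namespace GenShift

open Filter Topology Uniformity

variable {X Γ : Type*} {φ : Γ → Γ}

/-! ### Orbits of the map on indices -/

lemma iterate_shift_apply (φ : Γ → Γ) (n : ℕ) (x : Γ → X) (α : Γ) :
    (shift φ)^[n] x α = x (φ^[n] α) := by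
  induction n generalizing x with
  | zero => rfl
  | succ n ih =>
    rw [Function.iterate_succ_apply, ih, Function.iterate_succ_apply']
    rfl

lemma iterate_injective_of_not_isQuasiPeriodicPt {a : Γ} (ha : ¬ IsQuasiPeriodicPt φ a) :
    Function.Injective fun n : ℕ => φ^[n] a := by
  have key : ∀ m n : ℕ, m < n → φ^[m] a ≠ φ^[n] a := by
    -- Passing to the next iterate meets the requirement `m ≥ 1` of quasi-periodicity.
    intro m n hmn h
    refine ha ⟨n + 1, m + 1, by omega, by omega, ?_⟩
    rw [Function.iterate_succ_apply', Function.iterate_succ_apply', h]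
  intro m n h
  rcases lt_trichotomy m n with hlt | heq | hlt
  · exact (key m n hlt h).elim
  · exact heq
  · exact (key n m hlt h.symm).elim

lemma IsQuasiPeriodicPt.finite_range_iterate {a : Γ} (ha : IsQuasiPeriodicPt φ a) :
    (Set.range fun n : ℕ => φ^[n] a).Finite := by
  obtain ⟨n, m, hnm, -, h⟩ := ha
  refine ((Set.finite_Iio n).image fun k : ℕ => φ^[k] a).subset ?_
  rintro _ ⟨k, rfl⟩
  induction k using Nat.strong_induction_on with
  | _ k ih =>
    by_cases hk : k < n
    · exact ⟨k, hk, rfl⟩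
    · have hk' : φ^[k] a = φ^[k - n + m] a := by
        rw [Function.iterate_add_apply, ← h, ← Function.iterate_add_apply,
          Nat.sub_add_cancel (not_lt.1 hk)]
      simpa only [hk'] using ih (k - n + m) (by omega)

lemma exists_finite_superset_mapsTo (hφ : ∀ a, IsQuasiPeriodicPt φ a) {F : Set Γ}
    (hF : F.Finite) : ∃ G : Set Γ, G.Finite ∧ F ⊆ G ∧ Set.MapsTo φ G G := by
  refine ⟨⋃ a ∈ F, Set.range fun n : ℕ => φ^[n] a,
    hF.biUnion fun a _ => (hφ a).finite_range_iterate, fun a ha => ?_, fun b hb => ?_⟩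
  · exact Set.mem_biUnion ha ⟨0, rfl⟩
  · simp only [Set.mem_iUnion] at hb ⊢
    obtain ⟨a, ha, n, rfl⟩ := hb
    exact ⟨a, ha, n + 1, Function.iterate_succ_apply' φ n a⟩

lemma eqOn_iterate_shift {G : Set Γ} (hG : Set.MapsTo φ G G) {x y : Γ → X} {k n : ℕ}
    (h : Set.EqOn ((shift φ)^[k] x) ((shift φ)^[k] y) G) (hkn : k ≤ n) :
    Set.EqOn ((shift φ)^[n] x) ((shift φ)^[n] y) G := by
  intro α hα
  have := h (hG.iterate (n - k) hα)
  simpa only [iterate_shift_apply, ← Function.iterate_add_apply, Nat.add_sub_cancel' hkn] using this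

/-! ### The uniformity of the full shift space -/

variable (X Γ) in
/-- The relations "agreeing on `F`", with `F ⊆ Γ` finite, form a basis of the uniformity defined by
the metric; that is, the metric induces the product uniformity of discrete factors. -/
def HasCylinderBasis [MetricSpace (Γ → X)] : Prop :=
  (𝓤 (Γ → X)).HasBasis Set.Finite fun F => {p | Set.EqOn p.1 p.2 F}

lemma hasCylinderBasis [Finite X] [TopologicalSpace X] [DiscreteTopology X]
    [m : MetricSpace (Γ → X)]
    (hm : m.toPseudoMetricSpace.toUniformSpace.toTopologicalSpace = Pi.topologicalSpace) :
    HasCylinderBasis X Γ := by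
  let u : UniformSpace (Γ → X) := @Pi.uniformSpace Γ (fun _ => X) fun _ => ⊥
  have hu : u.toTopologicalSpace = Pi.topologicalSpace := by
    have hX : (‹TopologicalSpace X› : TopologicalSpace X) = ⊥ := DiscreteTopology.eq_bot
    subst hX
    rfl
  have huniq : m.toPseudoMetricSpace.toUniformSpace = u :=
    @unique_uniformity_of_compact _ Pi.topologicalSpace inferInstance _ _ hm hu
  have hbasis : (@uniformity (Γ → X) u).HasBasis Set.Finite
      fun F => {p | Set.EqOn p.1 p.2 F} := by
    have h1 : @uniformity (Γ → X) u =
        ⨅ α : Γ, 𝓟 {p : (Γ → X) × (Γ → X) | p.1 α = p.2 α} := by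
      rw [@Pi.uniformity Γ (fun _ => X) fun _ => ⊥]
      refine iInf_congr fun α => ?_
      rw [bot_uniformity, comap_principal]
      rfl
    rw [h1]
    convert hasBasis_iInf_principal_finite
      (fun α : Γ => {p : (Γ → X) × (Γ → X) | p.1 α = p.2 α}) using 2 with F
    ext p
    simp [Set.EqOn]
  unfold HasCylinderBasis
  rw [huniq]
  exact hbasis

lemma boundedSpace [Finite X] [TopologicalSpace X] [m : MetricSpace (Γ → X)]
    (hm : m.toPseudoMetricSpace.toUniformSpace.toTopologicalSpace = Pi.topologicalSpace) :
    BoundedSpace (Γ → X) := by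
  have : @CompactSpace (Γ → X) m.toPseudoMetricSpace.toUniformSpace.toTopologicalSpace := by
    rw [hm]
    infer_instance
  exact ⟨@IsCompact.isBounded _ m.toPseudoMetricSpace _
    (@isCompact_univ _ m.toPseudoMetricSpace.toUniformSpace.toTopologicalSpace this)⟩

section Metric

variable [MetricSpace (Γ → X)]

lemma HasCylinderBasis.exists_dist_lt (hB : HasCylinderBasis X Γ) {ε : ℝ} (hε : 0 < ε) :
    ∃ F : Set Γ, F.Finite ∧ ∀ x y : Γ → X, Set.EqOn x y F → dist x y < ε := by
  obtain ⟨F, hF, h⟩ := hB.mem_iff.1 (Metric.dist_mem_uniformity hε)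
  exact ⟨F, hF, fun x y hxy => h (show (x, y) ∈ {p : (Γ → X) × (Γ → X) | Set.EqOn p.1 p.2 F}
    from hxy)⟩

lemma HasCylinderBasis.setOf_apply_eq_mem_uniformity (hB : HasCylinderBasis X Γ) (a : Γ) :
    {p : (Γ → X) × (Γ → X) | p.1 a = p.2 a} ∈ 𝓤 (Γ → X) := by
  simpa using hB.mem_of_mem (Set.finite_singleton a)

lemma HasCylinderBasis.exists_lt_dist (hB : HasCylinderBasis X Γ) (a : Γ) :
    ∃ ε : ℝ, 0 < ε ∧ ∀ x y : Γ → X, x a ≠ y a → ε < dist x y := by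
  obtain ⟨ε, hε, h⟩ := Metric.mem_uniformity_dist.1 (hB.setOf_apply_eq_mem_uniformity a)
  refine ⟨ε / 2, half_pos hε, fun x y hxy => ?_⟩
  by_contra! hle
  exact hxy (h (hle.trans_lt (half_lt_self hε)))

lemma HasCylinderBasis.exists_cylinder_subset (hB : HasCylinderBasis X Γ) {V : Set (Γ → X)}
    (hV : IsOpen V) {x : Γ → X} (hx : x ∈ V) :
    ∃ F : Set Γ, F.Finite ∧ ∀ y : Γ → X, Set.EqOn y x F → y ∈ V := by
  obtain ⟨ε, hε, h⟩ := Metric.isOpen_iff.1 hV x hx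
  obtain ⟨F, hF, h'⟩ := hB.exists_dist_lt hε
  exact ⟨F, hF, fun y hy => h (h' y x hy)⟩

lemma HasCylinderBasis.setOf_eqOn_mem_nhds (hB : HasCylinderBasis X Γ) {F : Set Γ}
    (hF : F.Finite) (x : Γ → X) : {y : Γ → X | Set.EqOn x y F} ∈ 𝓝 x :=
  UniformSpace.ball_mem_nhds x (hB.mem_of_mem hF)

end Metric

/-! ### Implications between sensitivity notions -/

section General

variable {Z : Type*} [MetricSpace Z] {f : Z → Z}

lemma isBoundedUnder_dist [BoundedSpace Z] (x y : Z) :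
    IsBoundedUnder (· ≤ ·) atTop fun n : ℕ => dist (f^[n] x) (f^[n] y) := by
  obtain ⟨C, hC⟩ := Metric.boundedSpace_iff.1 ‹BoundedSpace Z›
  exact isBoundedUnder_of ⟨C, fun n => hC _ _⟩

lemma isBoundedUnder_ge_dist (x y : Z) :
    IsBoundedUnder (· ≥ ·) atTop fun n : ℕ => dist (f^[n] x) (f^[n] y) :=
  isBoundedUnder_of ⟨0, fun _ => dist_nonneg⟩

lemma IsStronglySensitive.isSensitive (h : IsStronglySensitive f) : IsSensitive f := by
  obtain ⟨ε, hε, h⟩ := h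
  refine ⟨ε, hε, fun x V hV hx => ?_⟩
  obtain ⟨y, hy, n, hn⟩ := h x V hV hx
  exact ⟨y, hy, n, hn n le_rfl⟩

lemma IsStronglySensitive.isAsymptoticSensitive [BoundedSpace Z] (h : IsStronglySensitive f) :
    IsAsymptoticSensitive f := by
  obtain ⟨ε, hε, h⟩ := h
  -- The strict inequality for the upper limit costs a smaller constant.
  refine ⟨ε / 2, half_pos hε, fun x V hV hx => ?_⟩
  obtain ⟨y, hy, n, hn⟩ := h x V hV hx
  refine ⟨y, hy, (half_lt_self hε).trans_le ?_⟩
  exact le_limsup_of_frequently_le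
    ((eventually_ge_atTop n).mono fun k hk => (hn k hk).le).frequently (isBoundedUnder_dist x y)

lemma IsStronglySensitive.isCofinitelySensitive (h : IsStronglySensitive f) :
    IsCofinitelySensitive f := by
  obtain ⟨ε, hε, h⟩ := h
  refine ⟨ε, hε, fun V hV ⟨x, hx⟩ => ?_⟩
  obtain ⟨y, hy, n, hn⟩ := h x V hV hx
  refine (Set.finite_Iio n).subset fun k hk => ?_
  by_contra hkn
  exact hk ⟨x, hx, y, hy, hn k (not_lt.1 hkn)⟩

lemma IsCofinitelySensitive.isSyndeticallySensitive (h : IsCofinitelySensitive f) :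
    IsSyndeticallySensitive f := by
  obtain ⟨ε, hε, h⟩ := h
  refine ⟨ε, hε, fun V hV hne => ?_⟩
  obtain ⟨M, hM⟩ := (h V hV hne).bddAbove
  refine ⟨M + 1, by omega, fun i _ => ⟨i + (M + 1), ⟨by omega, le_rfl⟩, ?_⟩⟩
  by_contra hc
  have := hM hc
  omega

lemma IsCofinitelySensitive.isMultiSensitive (h : IsCofinitelySensitive f) :
    IsMultiSensitive f := by
  obtain ⟨ε, hε, h⟩ := h
  refine ⟨ε, hε, fun k _ V hV hne => ?_⟩
  have hfin : (⋂ i, sepTimes f (V i) ε)ᶜ.Finite := by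
    rw [Set.compl_iInter]
    exact Set.finite_iUnion fun i => h _ (hV i) (hne i)
  simpa using hfin.infinite_compl.nonempty

lemma IsCofinitelySensitive.isErgodicallySensitive (h : IsCofinitelySensitive f) :
    IsErgodicallySensitive f := by
  obtain ⟨ε, hε, h⟩ := h
  refine ⟨ε, hε, fun V hV hne => ?_⟩
  have hfin := h V hV hne
  set S := sepTimes f V ε
  have hcard : ∀ n : ℕ, n + 1 ≤ (S ∩ Set.Iic n).ncard + Sᶜ.ncard := by
    intro n
    calc n + 1 = (Set.Iic n).ncard := by
          rw [← Finset.coe_Iic, Set.ncard_coe_finset, Nat.card_Iic]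
      _ ≤ ((S ∩ Set.Iic n) ∪ Sᶜ).ncard := by
          refine Set.ncard_le_ncard (fun k hk => ?_)
            (((Set.finite_Iic n).subset Set.inter_subset_right).union hfin)
          by_cases hkS : k ∈ S
          · exact Or.inl ⟨hkS, hk⟩
          · exact Or.inr hkS
      _ ≤ _ := Set.ncard_union_le _ _
  have hle : ∀ n : ℕ, (S ∩ Set.Iic n).ncard ≤ n + 1 := by
    intro n
    calc (S ∩ Set.Iic n).ncard ≤ (Set.Iic n).ncard :=
          Set.ncard_le_ncard Set.inter_subset_right (Set.finite_Iic n)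
      _ = n + 1 := by rw [← Finset.coe_Iic, Set.ncard_coe_finset, Nat.card_Iic]
  refine (one_half_pos (α := ℝ)).trans_le ?_
  refine le_limsup_of_frequently_le
    ((eventually_ge_atTop (2 * Sᶜ.ncard)).mono fun n hn => ?_).frequently
    (isBoundedUnder_of ⟨1, fun n => ?_⟩)
  · have h1 : ((n : ℝ) + 1) ≤ (S ∩ Set.Iic n).ncard + Sᶜ.ncard := by exact_mod_cast hcard n
    have h2 : 2 * (Sᶜ.ncard : ℝ) ≤ n := by exact_mod_cast hn
    rw [le_div_iff₀ (by positivity)]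
    linarith
  · have h1 : ((S ∩ Set.Iic n).ncard : ℝ) ≤ (n : ℝ) + 1 := by exact_mod_cast hle n
    exact div_le_one_of_le₀ h1 (by positivity)

/-- If the iterates of `f` are equicontinuous at a single point, then `f` is not sensitive in any
sense. -/
lemma not_sensitive_of_exists_isOpen [BoundedSpace Z] (x : Z)
    (h : ∀ ε : ℝ, 0 < ε → ∃ V : Set Z, IsOpen V ∧ x ∈ V ∧
      ∀ y ∈ V, ∀ z ∈ V, ∀ n : ℕ, dist (f^[n] y) (f^[n] z) < ε) :
    ¬ IsSensitive f ∧ ¬ IsAsymptoticSensitive f ∧ ¬ IsSyndeticallySensitive f ∧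
      ¬ IsMultiSensitive f ∧ ¬ IsErgodicallySensitive f := by
  have hsep : ∀ ε : ℝ, 0 < ε → ∃ V : Set Z, IsOpen V ∧ V.Nonempty ∧ sepTimes f V ε = ∅ := by
    intro ε hε
    obtain ⟨V, hV, hx, hd⟩ := h ε hε
    refine ⟨V, hV, ⟨x, hx⟩, Set.eq_empty_of_forall_notMem ?_⟩
    rintro n ⟨y, hy, z, hz, hlt⟩
    exact lt_asymm hlt (hd y hy z hz n)
  refine ⟨?_, ?_, ?_, ?_, ?_⟩
  · rintro ⟨ε, hε, hs⟩
    obtain ⟨V, hV, hx, hd⟩ := h ε hε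
    obtain ⟨y, hy, n, hn⟩ := hs x V hV hx
    exact lt_asymm hn (hd x hx y hy n)
  · rintro ⟨ε, hε, hs⟩
    obtain ⟨V, hV, hx, hd⟩ := h ε hε
    obtain ⟨y, hy, hn⟩ := hs x V hV hx
    refine hn.not_ge (limsup_le_of_le (isBoundedUnder_ge_dist x y).isCoboundedUnder_le ?_)
    exact Eventually.of_forall fun n => (hd x hx y hy n).le
  · rintro ⟨ε, hε, hs⟩
    obtain ⟨V, hV, hne, he⟩ := hsep ε hε
    obtain ⟨N, -, hN⟩ := hs V hV hne
    simpa [he] using hN 1 le_rfl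
  · rintro ⟨ε, hε, hs⟩
    obtain ⟨V, hV, hne, he⟩ := hsep ε hε
    simpa [he] using hs 1 le_rfl (fun _ => V) (fun _ => hV) fun _ => hne
  · rintro ⟨ε, hε, hs⟩
    obtain ⟨V, hV, hne, he⟩ := hsep ε hε
    simpa [he] using hs V hV hne

end General

/-! ### Maps all of whose points are quasi-periodic -/

lemma exists_finset_forall_eqOn [Finite X] [Nonempty X] {G : Set Γ} (hG : G.Finite) :
    ∃ s : Finset (Γ → X), ∀ x : Γ → X, ∃ y ∈ s, Set.EqOn x y G := by
  classical
  have := hG.to_subtype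
  have p : X := Classical.arbitrary X
  refine ⟨(Set.finite_range fun (u : G → X) (γ : Γ) =>
    if h : γ ∈ G then u ⟨γ, h⟩ else p).toFinset, fun x => ?_⟩
  refine ⟨fun γ => if γ ∈ G then x γ else p, ?_, fun γ hγ => by simp [hγ]⟩
  rw [Set.Finite.mem_toFinset]
  exact ⟨fun γ => x γ, by ext γ; simp⟩

section QuasiPeriodic

variable [MetricSpace (Γ → X)]

/-- If all points are quasi-periodic, agreement on a suitable finite set at a time `k` forces the
orbits to be `ε`-close from then on. The case `k = 0` is uniform equicontinuity of the iterates. -/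
lemma exists_finite_forall_dist_iterate_lt (hB : HasCylinderBasis X Γ)
    (hφ : ∀ a, IsQuasiPeriodicPt φ a) {ε : ℝ} (hε : 0 < ε) :
    ∃ G : Set Γ, G.Finite ∧ ∀ x y : Γ → X, ∀ k : ℕ,
      Set.EqOn ((shift φ)^[k] x) ((shift φ)^[k] y) G →
        ∀ n ≥ k, dist ((shift φ)^[n] x) ((shift φ)^[n] y) < ε := by
  obtain ⟨F, hF, hd⟩ := hB.exists_dist_lt hε
  obtain ⟨G, hG, hFG, hmaps⟩ := exists_finite_superset_mapsTo hφ hF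
  exact ⟨G, hG, fun x y k hxy n hn => hd _ _ ((eqOn_iterate_shift hmaps hxy hn).mono hFG)⟩

lemma exists_isOpen_forall_dist_iterate_lt (hB : HasCylinderBasis X Γ)
    (hφ : ∀ a, IsQuasiPeriodicPt φ a) (x : Γ → X) {ε : ℝ} (hε : 0 < ε) :
    ∃ V : Set (Γ → X), IsOpen V ∧ x ∈ V ∧
      ∀ y ∈ V, ∀ z ∈ V, ∀ n : ℕ, dist ((shift φ)^[n] y) ((shift φ)^[n] z) < ε := by
  obtain ⟨G, hG, hd⟩ := exists_finite_forall_dist_iterate_lt hB hφ hε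
  refine ⟨interior {y : Γ → X | Set.EqOn x y G}, isOpen_interior,
    mem_interior_iff_mem_nhds.2 (hB.setOf_eqOn_mem_nhds hG x), fun y hy z hz n => ?_⟩
  have hy' : Set.EqOn x y G := interior_subset hy
  have hz' : Set.EqOn x z G := interior_subset hz
  exact hd y z 0 (hy'.symm.trans hz') n n.zero_le

lemma not_hasScrambledPair_of_forall_isQuasiPeriodicPt [BoundedSpace (Γ → X)]
    (hB : HasCylinderBasis X Γ) (hφ : ∀ a, IsQuasiPeriodicPt φ a) :
    ¬ HasScrambledPair (shift φ : (Γ → X) → (Γ → X)) := by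
  rintro ⟨x, y, hinf, hsup⟩
  refine hsup.not_ge (le_of_forall_pos_le_add fun ε hε => ?_)
  obtain ⟨G, hG, hd⟩ := exists_finite_forall_dist_iterate_lt hB hφ hε
  obtain ⟨δ, hδ, hclose⟩ := Metric.mem_uniformity_dist.1 (hB.mem_of_mem hG)
  have hfreq : ∃ᶠ n : ℕ in atTop, dist ((shift φ)^[n] x) ((shift φ)^[n] y) < δ :=
    frequently_lt_of_liminf_lt (isBoundedUnder_dist x y).isCoboundedUnder_ge (by rwa [hinf])
  obtain ⟨k, hk⟩ := hfreq.exists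
  rw [zero_add]
  refine limsup_le_of_le (isBoundedUnder_ge_dist x y).isCoboundedUnder_le ?_
  exact (eventually_ge_atTop k).mono fun n hn => (hd x y k (hclose hk) n hn).le

lemma not_isTopologicallyChaotic_of_forall_isQuasiPeriodicPt [Finite X] [Nonempty X]
    (hB : HasCylinderBasis X Γ) (hφ : ∀ a, IsQuasiPeriodicPt φ a) :
    ¬ IsTopologicallyChaotic (shift φ : (Γ → X) → (Γ → X)) := by
  refine not_lt.2 (iSup₂_le fun U hU => ?_)
  obtain ⟨F, hF, hFU⟩ := hB.mem_iff.1 hU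
  obtain ⟨G, hG, hFG, hmaps⟩ := exists_finite_superset_mapsTo hφ hF
  obtain ⟨s, hs⟩ := exists_finset_forall_eqOn (X := X) hG
  obtain ⟨y₀, hy₀, -⟩ := hs fun _ => Classical.arbitrary X
  -- One finite set is a dynamical cover for all times.
  have hcover : ∀ n, Dynamics.IsDynCoverOf (shift φ) Set.univ U n (s : Set (Γ → X)) := by
    intro n x _
    obtain ⟨y, hy, hxy⟩ := hs x
    refine ⟨y, hy, Dynamics.mem_dynEntourage.2 fun k _ => hFU ?_⟩
    exact (eqOn_iterate_shift (k := 0) hmaps hxy k.zero_le).mono hFG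
  have hs0 : ((s.card : ℕ) : ENNReal) ≠ 0 := by
    exact_mod_cast (Finset.card_pos.2 ⟨y₀, hy₀⟩).ne'
  rw [← ExpGrowth.expGrowthSup_const hs0 (ENNReal.natCast_ne_top _)]
  refine ExpGrowth.expGrowthSup_monotone fun n => ?_
  have := ENat.toENNReal_mono (hcover n).coverMincard_le_card
  simpa using this

end QuasiPeriodic

/-! ### Maps with a point which is not quasi-periodic -/

/-- Prescribing the `n` values along `a, φ a, …, φ^[n-1] a` out of two symbols gives a net of
cardinality `2 ^ n`. -/
lemma two_pow_le_netMaxcard [Nontrivial X] {a : Γ} (ha : ¬ IsQuasiPeriodicPt φ a) (n : ℕ) :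
    2 ^ n ≤ Dynamics.netMaxcard (shift φ : (Γ → X) → (Γ → X)) Set.univ
      {p : (Γ → X) × (Γ → X) | p.1 a = p.2 a} n := by
  classical
  have hinj := iterate_injective_of_not_isQuasiPeriodicPt ha
  obtain ⟨p, q, hpq⟩ := exists_pair_ne X
  let x : (Fin n → Bool) → Γ → X := fun u γ =>
    if ∃ k : Fin n, φ^[k] a = γ ∧ u k = true then q else p
  have hx : ∀ u (k : Fin n), x u (φ^[k] a) = if u k = true then q else p := by
    intro u k
    refine if_congr ⟨?_, fun h => ⟨k, rfl, h⟩⟩ rfl rfl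
    rintro ⟨j, hj, hu⟩
    rwa [← Fin.ext (hinj hj)]
  have hcode : ∀ u v, (∀ k : Fin n, x u (φ^[k] a) = x v (φ^[k] a)) → u = v := by
    intro u v h
    ext k
    have hk := h k
    rw [hx, hx] at hk
    cases hu : u k <;> cases hv : v k <;> simp_all
  have hxinj : Function.Injective x := fun u v h => hcode u v fun k => by rw [h]
  have hnet : Dynamics.IsDynNetIn (shift φ : (Γ → X) → (Γ → X)) Set.univ
      {p : (Γ → X) × (Γ → X) | p.1 a = p.2 a} n
      ((Finset.univ.image x : Finset (Γ → X)) : Set (Γ → X)) := by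
    refine ⟨Set.subset_univ _, ?_⟩
    rintro y hy z hz hne
    obtain ⟨u, -, rfl⟩ := Finset.mem_image.1 (Finset.mem_coe.1 hy)
    obtain ⟨v, -, rfl⟩ := Finset.mem_image.1 (Finset.mem_coe.1 hz)
    refine Set.disjoint_left.2 fun w hu hv => hne (congrArg x (hcode u v fun k => ?_))
    have h1 : (shift φ)^[k] (x u) a = (shift φ)^[k] w a := Dynamics.mem_dynEntourage.1 hu k k.2
    have h2 : (shift φ)^[k] (x v) a = (shift φ)^[k] w a := Dynamics.mem_dynEntourage.1 hv k k.2
    simpa only [iterate_shift_apply] using h1.trans h2.symm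
  have := hnet.card_le_netMaxcard
  rw [Finset.card_image_of_injective _ hxinj] at this
  simpa using this

section NotQuasiPeriodic

variable [MetricSpace (Γ → X)]

lemma isStronglySensitive_of_not_isQuasiPeriodicPt [Nontrivial X] (hB : HasCylinderBasis X Γ)
    {a : Γ} (ha : ¬ IsQuasiPeriodicPt φ a) :
    IsStronglySensitive (shift φ : (Γ → X) → (Γ → X)) := by
  classical
  have hinj := iterate_injective_of_not_isQuasiPeriodicPt ha
  obtain ⟨ε, hε, hd⟩ := hB.exists_lt_dist a
  refine ⟨ε, hε, fun x V hV hx => ?_⟩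
  obtain ⟨F, hF, hFV⟩ := hB.exists_cylinder_subset hV hx
  obtain ⟨M, hM⟩ := (hF.preimage hinj.injOn).bddAbove
  choose g hg using fun p : X => exists_ne p
  refine ⟨fun γ => if γ ∈ F then x γ else g (x γ), hFV _ fun γ hγ => by simp [hγ], M + 1,
    fun n hn => hd _ _ ?_⟩
  have hnF : φ^[n] a ∉ F := fun h => by
    have := hM h
    omega
  simpa [iterate_shift_apply, hnF] using (hg (x (φ^[n] a))).symm

lemma isTopologicallyChaotic_of_not_isQuasiPeriodicPt [Nontrivial X] (hB : HasCylinderBasis X Γ)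
    {a : Γ} (ha : ¬ IsQuasiPeriodicPt φ a) :
    IsTopologicallyChaotic (shift φ : (Γ → X) → (Γ → X)) := by
  refine lt_of_lt_of_le ?_ (Dynamics.netEntropyEntourage_le_coverEntropy _ _
    (hB.setOf_apply_eq_mem_uniformity a))
  have hlog : (0 : EReal) < ENNReal.log 2 := by
    rw [← ENNReal.log_one]
    exact ENNReal.log_strictMono (by norm_num)
  refine hlog.trans_le ?_
  rw [← ExpGrowth.expGrowthSup_pow]
  refine ExpGrowth.expGrowthSup_monotone fun n => ?_
  have := ENat.toENNReal_mono (two_pow_le_netMaxcard (X := X) ha n)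
  simpa using this

end NotQuasiPeriodic

/-! ### An uncountable scrambled set -/

open Classical in
/-- The point of `X^Γ` with value `q` at `φ^(m²)(a)` whenever the entry of `s` at the first
component of the pair coded by `m` is `true`, and with value `p` elsewhere. Every entry of `s` is
thus recorded infinitely often, at places with growing gaps. -/
noncomputable def codedPoint (φ : Γ → Γ) (a : Γ) (p q : X) (s : ℕ → Bool) : Γ → X := fun γ =>
  if ∃ m : ℕ, φ^[m ^ 2] a = γ ∧ s m.unpair.1 = true then q else p

section CodedPoint

variable {a : Γ} {p q : X}

lemma codedPoint_iterate_sq (ha : ¬ IsQuasiPeriodicPt φ a) (s : ℕ → Bool) (m : ℕ) :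
    codedPoint φ a p q s (φ^[m ^ 2] a) = if s m.unpair.1 = true then q else p := by
  classical
  refine if_congr ⟨?_, fun h => ⟨m, rfl, h⟩⟩ rfl rfl
  rintro ⟨j, hj, hs⟩
  have : j ^ 2 = m ^ 2 := iterate_injective_of_not_isQuasiPeriodicPt ha hj
  rwa [← Nat.pow_left_injective two_ne_zero this]

lemma codedPoint_eq_of_forall_ne {γ : Γ} (h : ∀ m : ℕ, φ^[m ^ 2] a ≠ γ) (s : ℕ → Bool) :
    codedPoint φ a p q s γ = p :=
  if_neg fun ⟨m, hm, _⟩ => h m hm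

lemma frequently_codedPoint_ne (ha : ¬ IsQuasiPeriodicPt φ a) (hpq : p ≠ q) {s t : ℕ → Bool}
    (hst : s ≠ t) :
    ∃ᶠ n : ℕ in atTop, codedPoint φ a p q s (φ^[n] a) ≠ codedPoint φ a p q t (φ^[n] a) := by
  obtain ⟨i, hi⟩ := Function.ne_iff.1 hst
  refine frequently_atTop.2 fun N => ⟨(Nat.pair i N) ^ 2, ?_, ?_⟩
  · exact (Nat.right_le_pair i N).trans (Nat.le_self_pow two_ne_zero _)
  · rw [codedPoint_iterate_sq ha, codedPoint_iterate_sq ha, Nat.unpair_pair]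
    have hqp : q ≠ p := hpq.symm
    cases hs : s i <;> cases ht : t i <;> simp_all

/-- At time `N² + N` the orbit of any given index avoids all `φ^(m²)(a)`, once `N` exceeds the time
shift between that orbit and the orbit of `a`. -/
lemma eventually_forall_iterate_sq_ne (ha : ¬ IsQuasiPeriodicPt φ a) (α : Γ) :
    ∀ᶠ N : ℕ in atTop, ∀ m : ℕ, φ^[m ^ 2] a ≠ φ^[N ^ 2 + N] α := by
  by_cases h : ∃ i j : ℕ, φ^[i] α = φ^[j] a
  · obtain ⟨i, j, hij⟩ := h
    refine (eventually_gt_atTop (i + j)).mono fun N hN m hm => ?_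
    have hiN : i ≤ N ^ 2 + N := by nlinarith
    have hshift : φ^[N ^ 2 + N] α = φ^[N ^ 2 + N - i + j] a := by
      rw [Function.iterate_add_apply _ _ j, ← hij, ← Function.iterate_add_apply,
        Nat.sub_add_cancel hiN]
    have hm' : m ^ 2 = N ^ 2 + N - i + j :=
      iterate_injective_of_not_isQuasiPeriodicPt ha (hm.trans hshift)
    -- This number lies strictly between the consecutive squares `N²` and `(N + 1)²`.
    have h1 : N ^ 2 < m ^ 2 := by omega
    have h2 : m ^ 2 < (N + 1) ^ 2 := by
      have : (N + 1) ^ 2 = N ^ 2 + 2 * N + 1 := by ring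
      omega
    have h3 := lt_of_pow_lt_pow_left₀ 2 (Nat.zero_le _) h1
    have h4 := lt_of_pow_lt_pow_left₀ 2 (Nat.zero_le _) h2
    omega
  · exact Eventually.of_forall fun N m hm => h ⟨_, _, hm.symm⟩

variable [MetricSpace (Γ → X)]

lemma isScrambledPair_codedPoint [BoundedSpace (Γ → X)] (hB : HasCylinderBasis X Γ)
    (ha : ¬ IsQuasiPeriodicPt φ a) (hpq : p ≠ q) {s t : ℕ → Bool} (hst : s ≠ t) :
    IsScrambledPair (shift φ) (codedPoint φ a p q s) (codedPoint φ a p q t) := by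
  constructor
  · refine le_antisymm (le_of_forall_pos_le_add fun ε hε => ?_) ?_
    · obtain ⟨F, hF, hd⟩ := hB.exists_dist_lt hε
      have hev : ∀ᶠ N : ℕ in atTop, ∀ α ∈ F, ∀ m : ℕ, φ^[m ^ 2] a ≠ φ^[N ^ 2 + N] α :=
        (eventually_all_finite hF).2 fun α _ => eventually_forall_iterate_sq_ne ha α
      have hfreq : ∃ᶠ n : ℕ in atTop, dist ((shift φ)^[n] (codedPoint φ a p q s))
          ((shift φ)^[n] (codedPoint φ a p q t)) ≤ ε := by
        refine frequently_atTop.2 fun M => ?_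
        obtain ⟨N, hN, hMN⟩ := (hev.and (eventually_ge_atTop M)).exists
        refine ⟨N ^ 2 + N, hMN.trans (Nat.le_add_left _ _), (hd _ _ fun α hα => ?_).le⟩
        rw [iterate_shift_apply, iterate_shift_apply, codedPoint_eq_of_forall_ne (hN α hα),
          codedPoint_eq_of_forall_ne (hN α hα)]
      rw [zero_add]
      exact liminf_le_of_frequently_le hfreq (isBoundedUnder_ge_dist _ _)
    · exact le_liminf_of_le (isBoundedUnder_dist _ _).isCoboundedUnder_ge
        (Eventually.of_forall fun _ => dist_nonneg)
  · obtain ⟨ε, hε, hd⟩ := hB.exists_lt_dist a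
    refine hε.trans_le (le_limsup_of_frequently_le ?_ (isBoundedUnder_dist _ _))
    refine (frequently_codedPoint_ne ha hpq hst).mono fun n hn => (hd _ _ ?_).le
    rwa [iterate_shift_apply, iterate_shift_apply]

lemma isLiYorkeChaotic_of_not_isQuasiPeriodicPt [Nontrivial X] [BoundedSpace (Γ → X)]
    (hB : HasCylinderBasis X Γ) (ha : ¬ IsQuasiPeriodicPt φ a) :
    IsLiYorkeChaotic (shift φ : (Γ → X) → (Γ → X)) := by
  obtain ⟨p, q, hpq⟩ := exists_pair_ne X
  have hinj : Function.Injective (codedPoint φ a p q) := by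
    intro s t h
    by_contra hst
    obtain ⟨n, hn⟩ := (frequently_codedPoint_ne ha hpq hst).exists
    exact hn (by rw [h])
  have hunc : ¬ (Set.range (codedPoint φ a p q)).Countable := by
    intro hc
    have : Countable (Set.range (codedPoint φ a p q)) := hc.to_subtype
    have : Countable (ℕ → Bool) := (Set.rangeFactorization_injective.2 hinj).countable
    classical
    obtain ⟨e, he⟩ := exists_injective_nat (ℕ → Bool)
    refine Function.cantor_injective (fun S : Set ℕ => e fun n => decide (n ∈ S)) fun S T h => ?_
    ext n
    simpa using congrFun (he h) n
  refine ⟨Set.range (codedPoint φ a p q), hunc, ?_, ?_⟩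
  · by_contra hsub
    exact hunc (Set.not_nontrivial_iff.1 hsub).countable
  · rintro _ ⟨s, rfl⟩ _ ⟨t, rfl⟩ hne
    exact isScrambledPair_codedPoint hB ha hpq fun h => hne (by rw [h])

end CodedPoint

end GenShift

theorem mainTheorem3 {X Γ : Type*} [Finite X] [Nontrivial X]
    [TopologicalSpace X] [DiscreteTopology X] [Nonempty Γ] [Countable Γ] (φ : Γ → Γ)
    -- an arbitrary metric on `X^Γ` compatible with the product topology
    [m : MetricSpace (Γ → X)]
    (hm : m.toPseudoMetricSpace.toUniformSpace.toTopologicalSpace = Pi.topologicalSpace) :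
    List.TFAE [
      GenShift.IsLiYorkeChaotic (GenShift.shift φ : (Γ → X) → (Γ → X)),
      GenShift.HasScrambledPair (GenShift.shift φ : (Γ → X) → (Γ → X)),
      GenShift.IsTopologicallyChaotic (GenShift.shift φ : (Γ → X) → (Γ → X)),
      GenShift.IsSensitive (GenShift.shift φ : (Γ → X) → (Γ → X)),
      GenShift.IsStronglySensitive (GenShift.shift φ : (Γ → X) → (Γ → X)),
      GenShift.IsAsymptoticSensitive (GenShift.shift φ : (Γ → X) → (Γ → X)),
      GenShift.IsSyndeticallySensitive (GenShift.shift φ : (Γ → X) → (Γ → X)),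
      GenShift.IsCofinitelySensitive (GenShift.shift φ : (Γ → X) → (Γ → X)),
      GenShift.IsMultiSensitive (GenShift.shift φ : (Γ → X) → (Γ → X)),
      GenShift.IsErgodicallySensitive (GenShift.shift φ : (Γ → X) → (Γ → X)),
      ∃ a : Γ, ¬ GenShift.IsQuasiPeriodicPt φ a] := by
  have hB := GenShift.hasCylinderBasis hm
  have := GenShift.boundedSpace hm
  have hqp : (¬ ∃ a : Γ, ¬ GenShift.IsQuasiPeriodicPt φ a) →
      ∀ a, GenShift.IsQuasiPeriodicPt φ a := fun h => by simpa using h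
  have hns := fun h : ¬ ∃ a : Γ, ¬ GenShift.IsQuasiPeriodicPt φ a =>
    GenShift.not_sensitive_of_exists_isOpen (f := GenShift.shift φ)
      (fun _ : Γ => Classical.arbitrary X)
      fun _ hε => GenShift.exists_isOpen_forall_dist_iterate_lt hB (hqp h) _ hε
  tfae_have 1 → 2 := fun ⟨_, _, ⟨x, hx, y, hy, hne⟩, h⟩ => ⟨x, y, h x hx y hy hne⟩
  tfae_have 2 → 11 := fun h => by
    by_contra hc
    exact GenShift.not_hasScrambledPair_of_forall_isQuasiPeriodicPt hB (hqp hc) h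
  tfae_have 11 → 1 := fun ⟨_, ha⟩ => GenShift.isLiYorkeChaotic_of_not_isQuasiPeriodicPt hB ha
  tfae_have 11 → 3 := fun ⟨_, ha⟩ => GenShift.isTopologicallyChaotic_of_not_isQuasiPeriodicPt hB ha
  tfae_have 3 → 11 := fun h => by
    by_contra hc
    exact GenShift.not_isTopologicallyChaotic_of_forall_isQuasiPeriodicPt hB (hqp hc) h
  tfae_have 11 → 5 := fun ⟨_, ha⟩ => GenShift.isStronglySensitive_of_not_isQuasiPeriodicPt hB ha
  tfae_have 5 → 4 := fun h => h.isSensitive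
  tfae_have 5 → 6 := fun h => h.isAsymptoticSensitive
  tfae_have 5 → 8 := fun h => h.isCofinitelySensitive
  tfae_have 8 → 7 := fun h => h.isSyndeticallySensitive
  tfae_have 8 → 9 := fun h => h.isMultiSensitive
  tfae_have 8 → 10 := fun h => h.isErgodicallySensitive
  tfae_have 4 → 11 := fun h => by
    by_contra hc
    exact (hns hc).1 h
  tfae_have 6 → 11 := fun h => by
    by_contra hc
    exact (hns hc).2.1 h
  tfae_have 7 → 11 := fun h => by
    by_contra hc
    exact (hns hc).2.2.1 h
  tfae_have 9 → 11 := fun h => by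
    by_contra hc
    exact (hns hc).2.2.2.1 h
  tfae_have 10 → 11 := fun h => by
    by_contra hc
    exact (hns hc).2.2.2.2 h
  tfae_finish
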